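/- Let $\{X_t\}_{t\in\mathbb Z}$ be a real-valued, centered, second-order stationary process with $\mathrm{var}(X_0)>0$ on a probability space $(\Omega,\mathcal F,P)$. For $K\subset\mathbb Z$ let $V_K$ be the closed linear span of $\{X_k:k\in K\}$ in $L^2(\Omega,\mathcal F,P)$ and $P_K$ the orthogonal projection onto $V_K$. Assume that $\{X_t\}$ is purely nondeterministic, i.e. $\bigcap_{n\in\mathbb Z}V_{(-\infty,n]}=\{0\}$. Let $\xi_t=X_t-P_{(-\infty,t-1]}X_t$ be the innovations, and let $\{\psi_j\}_{j\ge0}$ ($\psi_0=1$) be the infinite-order MA coefficients, i.e. the coefficients of the Wold decomposition $X_t=\sum_{j=0}^\infty\psi_j\xi_{t-j}$. Let $\{\phi_j\}_{j\ge 0}$ ($\phi_0=-1$) be the infinite-order AR coefficients, given by $-\sum_{j=0}^\infty\phi_jz^j=\bigl(\sum_{j=0}^\infty\psi_jz^j\bigr)^{-1}$. Suppose that for some $\alpha\ge0$ $$\sum_{j=0}^\infty(1+j)^\alpha|\psi_j|<\infty\quad\text{and}\quad\sum_{j=0}^\infty(1+j)^\alpha|\phi_j|<\infty,\qquad(\mathrm{SM}_\alpha)$$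 and put $\|\psi\|_0=\sum_{j=0}^\infty|\psi_j|$ and $\|\phi\|_0=\sum_{j=0}^\infty|\phi_j|$. For integers $m,n\ge1$ let $\{\phi_k^m\}_{k\ge1}$ and $\{\phi_{k,n}^m\}_{k=1}^n$ be the $m$-step ahead infinite and finite predictor coefficients, determined by $$P_{(-\infty,n]}X_{n+m}=\sum_{k=1}^\infty\phi_k^mX_{n+1-k},\qquad P_{[1,n]}X_{n+m}=\sum_{k=1}^n\phi_{k,n}^mX_{n+1-k}.$$ Then $\sum_{k=1}^\infty|\phi_k^m|<\infty$ for every $m\ge1$, and the following hold. 1. For every $\varepsilon\in(0,1)$ there is an integer $N_1\ge1$, not depending on $m$, such that for all $m\ge1$ and all $n\ge N_1$ $$\sum_{k=1}^n|\phi_k^m-\phi_{k,n}^m|\le C_1\sum_{k=n+1}^\infty|\phi_k^m|,\qquad C_1=\frac{3-\varepsilon}{1-\varepsilon}\,\|\psi\|_0^2\,\|\phi\|_0^2 .$$ 2. $\sup_{m\ge1}\sum_{k=n+1}^\infty|\phi_k^m|$ is finite for every $n\ge 0$ and is $o(n^{-\alpha})$ as $n\to\infty$. 3. If $\alpha\ge1$,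 then $\sum_{m=1}^\infty\sum_{k=n+1}^\infty|\phi_k^m|$ is finite for every $n\ge 0$ and is $o(n^{-\alpha+1})$ as $n\to\infty$. -/

import Mathlib

open MeasureTheory ProbabilityTheory Filter Topology Asymptotics
open scoped BigOperators ENNReal

namespace LinearPrediction

/-- A real-valued process `X = (X_t)_{t ∈ ℤ}` is centered and second-order (weakly) stationary. -/
structure IsCenteredStationary {Ω : Type*} [MeasurableSpace Ω] (X : ℤ → Ω → ℝ)
    (P : Measure Ω) : Prop where
  memLp : ∀ t, MemLp (X t) 2 P
  centered : ∀ t, ∫ ω, X t ω ∂P = 0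
  cov_shift : ∀ s t h : ℤ, cov[X (s + h), X (t + h); P] = cov[X s, X t; P]

/-- The process viewed as a sequence of elements of the real Hilbert space `L²(Ω, P)`. -/
noncomputable def IsCenteredStationary.toL2 {Ω : Type*} [MeasurableSpace Ω] {X : ℤ → Ω → ℝ}
    {P : Measure Ω} (hX : IsCenteredStationary X P) (t : ℤ) : Lp ℝ 2 P :=
  (hX.memLp t).toLp (X t)

section Hilbert

variable {H : Type*} [NormedAddCommGroup H] [InnerProductSpace ℝ H] [CompleteSpace H]

/-- `V_K`, the closed linear span of `{x_k : k ∈ K}`. -/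
noncomputable def closedSpan (x : ℤ → H) (K : Set ℤ) : Submodule ℝ H :=
  (Submodule.span ℝ (x '' K)).topologicalClosure

/-- `P_K y`, the orthogonal projection of `y` onto `V_K`
(the best linear predictor of `y` given `{x_k : k ∈ K}`). -/
noncomputable def proj (x : ℤ → H) (K : Set ℤ) (y : H) : H :=
  (Submodule.span ℝ (x '' K)).topologicalClosure.starProjection y

/-- The remote past is trivial: `⋂ₙ V_{(-∞, n]} = {0}`. -/
def IsPurelyNondeterministic (x : ℤ → H) : Prop :=
  ⨅ n : ℤ, closedSpan x (Set.Iic n) = ⊥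

/-- The innovation `ε_t = x_t - P_{(-∞, t-1]} x_t`: the white noise of the Wold decomposition. -/
noncomputable def innovation (x : ℤ → H) (t : ℤ) : H :=
  x t - proj x (Set.Iic (t - 1)) (x t)

/-- The infinite-order moving average coefficients `ψ_j`: those of the Wold decomposition
`x_t = ∑_{j ≥ 0} ψ_j ε_{t-j}`, that is `ψ_j = ⟨x_0, ε_{-j}⟩ / σ²` with `σ² = ‖ε_0‖²`. -/
noncomputable def maCoeff (x : ℤ → H) (j : ℕ) : ℝ :=
  inner ℝ (x 0) (innovation x (-(j : ℤ))) / ‖innovation x 0‖ ^ 2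

/-- The infinite-order autoregressive coefficients `φ_j`, with `φ_0 = -1`:
`1 - ∑_{j ≥ 1} φ_j z^j = (∑_{j ≥ 0} ψ_j z^j)⁻¹`. -/
noncomputable def arCoeff (x : ℤ → H) (j : ℕ) : ℝ :=
  -(PowerSeries.coeff j (PowerSeries.mk (maCoeff x))⁻¹)

/-- `a` is a sequence of `m`-step ahead infinite predictor coefficients:
`P_{(-∞, n]} x_{n+m} = ∑_{k ≥ 1} a_k x_{n+1-k}` for all `n`, the series converging in norm.
(Only the entries `a_k` with `k ≥ 1` matter; they are unique when `ε_0 ≠ 0`.) -/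
def IsInfPredictor (x : ℤ → H) (m : ℕ) (a : ℕ → ℝ) : Prop :=
  ∀ n : ℤ, Tendsto (fun N : ℕ => ∑ k ∈ Finset.Icc 1 N, a k • x (n + 1 - k)) atTop
    (𝓝 (proj x (Set.Iic n) (x (n + m))))

/-- `a` is a sequence of `m`-step ahead finite predictor coefficients based on `x_1, …, x_n`:
`P_{[1, n]} x_{n+m} = ∑_{k=1}^n a_k x_{n+1-k}`.
(Only the entries `a_1, …, a_n` matter; they are unique when `x_1, …, x_n` are linearly
independent.) -/
def IsFinPredictor (x : ℤ → H) (m n : ℕ) (a : ℕ → ℝ) : Prop :=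
  ∑ k ∈ Finset.Icc 1 n, a k • x ((n : ℤ) + 1 - k) = proj x (Set.Icc 1 (n : ℤ)) (x (n + m))

/-- `φ_k^m`, the `m`-step ahead infinite predictor coefficients. -/
noncomputable def infPredCoeff (x : ℤ → H) (m : ℕ) : ℕ → ℝ :=
  Classical.epsilon (IsInfPredictor x m)

/-- `φ_{k,n}^m`, the `m`-step ahead finite predictor coefficients. -/
noncomputable def finPredCoeff (x : ℤ → H) (m n : ℕ) : ℕ → ℝ :=
  Classical.epsilon (IsFinPredictor x m n)

/-- The tail sum `∑_{k ≥ n+1} |φ_k^m|`. -/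
noncomputable def predTail (x : ℤ → H) (m n : ℕ) : ℝ :=
  ∑' k : ℕ, |infPredCoeff x m (n + 1 + k)|

/-- Short memory of order `α`: `∑ (1 + j)^α |ψ_j| < ∞` and `∑ (1 + j)^α |φ_j| < ∞`. -/
def IsShortMemory (x : ℤ → H) (α : ℝ) : Prop :=
  Summable (fun j : ℕ => (1 + (j : ℝ)) ^ α * |maCoeff x j|) ∧
  Summable (fun j : ℕ => (1 + (j : ℝ)) ^ α * |arCoeff x j|)

/-- `C₁ = (3 - ε) / (1 - ε) * ‖ψ‖₀² * ‖φ‖₀²`, both sums starting at `j = 0`. -/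
noncomputable def baxterConst (x : ℤ → H) (ε : ℝ) : ℝ :=
  (3 - ε) / (1 - ε) * (∑' j : ℕ, |maCoeff x j|) ^ 2 * (∑' j : ℕ, |arCoeff x j|) ^ 2

end Hilbert

end LinearPrediction

open LinearPrediction

/-! Read time backwards from `n`: index `k` stands for time `n + 1 - k`, so the past is `k ≥ 1`, the
window is `1 ≤ k ≤ n`, and `x (n + m)` sits at `k = 1 - m`. By the Wold decomposition, `f ↦ ∑ f_k
x_{n+1-k}` is convolution by `ψ` followed by synthesis from orthogonal innovations. Projection on
the past is then restriction to `k ≥ 1` (`proj_synth`), and the Gram operator is, up to the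
innovation variance, `ψ(S⁻¹)ψ(S)` with `S` the unit shift on `ℓ¹(ℤ)`.

Baxter's inequality (`baxter`): the difference `w` of the finite and infinite predictors vanishes
for `k ≤ 0`, and the normal equations say that `ψ(S⁻¹)ψ(S)w` vanishes on `[1, n]`. What remains is a
left part `u` and a right part `v`. Inverting one factor at a time bounds `u` by a small multiple of
`v`, since crossing the window costs more than `n` shifts, and bounds `v` by the tail of `w` beyond
`n` plus a multiple of `u`. For large `n` the loop closes (`norm_le_of_finite_section`). The
threshold on `n` involves only `ψ` and `φ`, hence not `m`.

Tails (`predTail_succ_le`): the tail of the predictor beyond `n` is at most a Cauchy product of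
`|ψ_l|` with the tails of `φ`. Monotonicity of the tails gives the supremum over `m`, and summing
the Cauchy product gives the series over `m`. -/

namespace LinearPrediction

/-! ### Shifts, restrictions and one-sided convolutions on `ℓ¹(ℤ)`. -/

/-- The Banach space `ℓ¹(ℤ)` of absolutely summable real sequences indexed by `ℤ`. -/
abbrev EllOne : Type := lp (fun _ : ℤ => ℝ) 1

namespace EllOne

/-- The unit sequence at `k`. -/
noncomputable def unit (k : ℤ) : EllOne := lp.single 1 k (1 : ℝ)

theorem hasSum_norm (f : EllOne) : HasSum (fun k => |f k|) ‖f‖ := by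
  have h := lp.hasSum_norm (p := 1) (by simp) f
  simpa [Real.norm_eq_abs] using h

theorem summable_abs (f : EllOne) : Summable fun k => |f k| := (hasSum_norm f).summable

theorem norm_eq_tsum (f : EllOne) : ‖f‖ = ∑' k, |f k| := (hasSum_norm f).tsum_eq.symm

theorem norm_unit (k : ℤ) : ‖unit k‖ = 1 := by
  simp [unit, lp.norm_single]

theorem unit_apply (k i : ℤ) : unit k i = if i = k then 1 else 0 := by
  simp [unit, Pi.single_apply]

theorem hasSum_unit (f : EllOne) : HasSum (fun k => f k • unit k) f := by
  have h := lp.hasSum_single (p := 1) (by simp) f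
  simpa [unit, ← lp.single_smul] using h

/-- The unit sequences span a dense subspace, so identities between bounded operators need checking
on one basis vector only. -/
theorem ext_unit {F : Type*} [NormedAddCommGroup F] [NormedSpace ℝ F] {S T : EllOne →L[ℝ] F}
    (h : ∀ k, S (unit k) = T (unit k)) : S = T := by
  ext f
  have hS := (hasSum_unit f).mapL S
  have hT := (hasSum_unit f).mapL T
  simp only [map_smul, h] at hS hT
  exact hS.unique hT

section Lift

variable {F : Type*} [NormedAddCommGroup F] [NormedSpace ℝ F] [CompleteSpace F]

theorem summable_smul (f : EllOne) {y : ℤ → F} {C : ℝ} (hy : ∀ k, ‖y k‖ ≤ C) :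
    Summable fun k => f k • y k := by
  refine Summable.of_norm_bounded ((summable_abs f).mul_right C) fun k => ?_
  rw [norm_smul, Real.norm_eq_abs]
  exact mul_le_mul_of_nonneg_left (hy k) (abs_nonneg _)

/-- The bounded operator `f ↦ ∑ₖ fₖ yₖ` on `ℓ¹(ℤ)` attached to a bounded family `y`. -/
noncomputable def lift (y : ℤ → F) (C : ℝ) (hy : ∀ k, ‖y k‖ ≤ C) : EllOne →L[ℝ] F :=
  LinearMap.mkContinuous
    { toFun := fun f => ∑' k, f k • y k
      map_add' := fun f g => by
        rw [← (summable_smul f hy).tsum_add (summable_smul g hy)]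
        simp [add_smul]
      map_smul' := fun c f => by
        simp only [lp.coeFn_smul, RingHom.id_apply]
        rw [← (summable_smul f hy).tsum_const_smul]
        simp [mul_smul] } C fun f => by
      refine tsum_of_norm_bounded ((hasSum_norm f).mul_left C) fun k => ?_
      rw [norm_smul, Real.norm_eq_abs, mul_comm]
      exact mul_le_mul_of_nonneg_right (hy k) (abs_nonneg _)

theorem lift_hasSum (y : ℤ → F) (C : ℝ) (hy : ∀ k, ‖y k‖ ≤ C) (f : EllOne) :
    HasSum (fun k => f k • y k) (lift y C hy f) :=
  (summable_smul f hy).hasSum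

theorem lift_unit (y : ℤ → F) (C : ℝ) (hy : ∀ k, ‖y k‖ ≤ C) (k : ℤ) :
    lift y C hy (unit k) = y k := by
  refine (lift_hasSum y C hy (unit k)).unique ?_
  convert hasSum_ite_eq k (y k) using 2 with i
  rw [unit_apply]
  split_ifs with h <;> simp [h]

theorem norm_lift_le (y : ℤ → F) (C : ℝ) (hy : ∀ k, ‖y k‖ ≤ C) : ‖lift y C hy‖ ≤ C :=
  LinearMap.mkContinuous_norm_le _ ((norm_nonneg _).trans (hy 0)) _

end Lift

/-- Evaluation at `i`. -/
noncomputable def coord (i : ℤ) : EllOne →L[ℝ] ℝ := lp.evalCLM ℝ (fun _ : ℤ => ℝ) 1 i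

theorem coord_apply (i : ℤ) (f : EllOne) : coord i f = f i := rfl

/-- The shift `(S_t f)(i) = f (i - t)`. -/
noncomputable def shift (t : ℤ) : EllOne →L[ℝ] EllOne :=
  lift (fun k => unit (k + t)) 1 fun _ => (norm_unit _).le

theorem shift_unit (t k : ℤ) : shift t (unit k) = unit (k + t) := lift_unit _ _ _ k

theorem norm_shift_le (t : ℤ) : ‖shift t‖ ≤ 1 := norm_lift_le _ _ _

theorem shift_apply (t : ℤ) (f : EllOne) (i : ℤ) : shift t f i = f (i - t) := by
  have : (coord i).comp (shift t) = coord (i - t) := ext_unit fun k => by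
    simp only [ContinuousLinearMap.comp_apply, shift_unit, coord_apply, unit_apply, sub_eq_iff_eq_add]
  exact DFunLike.congr_fun this f

theorem shift_mul (s t : ℤ) : shift s * shift t = shift (s + t) := ext_unit fun k => by
  simp only [mul_apply_eq_comp, shift_unit]
  congr 1; ring

theorem shift_zero : shift 0 = 1 := ext_unit fun k => by simp [shift_unit]

open Classical in
/-- Restriction of a sequence to `s`. -/
noncomputable def restrict (s : Set ℤ) : EllOne →L[ℝ] EllOne :=
  lift (fun k => if k ∈ s then unit k else 0) 1 fun k => by
    split_ifs <;> simp [norm_unit]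

open Classical in
theorem restrict_unit (s : Set ℤ) (k : ℤ) :
    restrict s (unit k) = if k ∈ s then unit k else 0 := lift_unit _ _ _ k

theorem norm_restrict_le (s : Set ℤ) : ‖restrict s‖ ≤ 1 := norm_lift_le _ _ _

theorem norm_restrict_apply_le (s : Set ℤ) (f : EllOne) : ‖restrict s f‖ ≤ ‖f‖ := by
  simpa using (restrict s).le_of_opNorm_le (norm_restrict_le s) f

open Classical in
theorem restrict_apply (s : Set ℤ) (f : EllOne) (i : ℤ) :
    restrict s f i = if i ∈ s then f i else 0 := by
  have : (coord i).comp (restrict s) = if i ∈ s then coord i else 0 := ext_unit fun k => by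
    simp only [ContinuousLinearMap.comp_apply, restrict_unit, coord_apply]
    by_cases hk : k ∈ s <;> by_cases hi : i ∈ s <;> simp [hk, hi, coord_apply, unit_apply] <;>
      rintro rfl <;> contradiction
  have h := DFunLike.congr_fun this f
  split_ifs at h ⊢ <;> exact h

theorem restrict_eq_self {s : Set ℤ} {f : EllOne} (h : ∀ i ∉ s, f i = 0) : restrict s f = f := by
  ext i
  rw [restrict_apply]
  split_ifs with hi
  · rfl
  · exact (h i hi).symm

theorem restrict_eq_zero {s : Set ℤ} {f : EllOne} (h : ∀ i ∈ s, f i = 0) : restrict s f = 0 := by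
  ext i
  rw [restrict_apply]
  split_ifs with hi
  · exact h i hi
  · rfl

/-- The operator `∑ⱼ cⱼ S_{r j}` of convolution by the one-sided sequence `c`,
forwards for `r = 1` and backwards for `r = -1`. -/
noncomputable def conv (r : ℤ) (c : ℕ → ℝ) : EllOne →L[ℝ] EllOne :=
  ∑' j : ℕ, c j • shift (r * j)

variable {r : ℤ} {c d : ℕ → ℝ}

theorem norm_smul_shift_le (r : ℤ) (c : ℕ → ℝ) (j : ℕ) : ‖c j • shift (r * j)‖ ≤ |c j| := by
  rw [norm_smul, Real.norm_eq_abs]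
  exact mul_le_of_le_one_right (abs_nonneg _) (norm_shift_le _)

theorem summable_norm_conv (r : ℤ) (hc : Summable fun j => |c j|) :
    Summable fun j : ℕ => ‖c j • shift (r * j)‖ :=
  Summable.of_nonneg_of_le (fun _ => norm_nonneg _) (norm_smul_shift_le r c) hc

theorem hasSum_conv (r : ℤ) (hc : Summable fun j => |c j|) :
    HasSum (fun j : ℕ => c j • shift (r * j)) (conv r c) :=
  (summable_norm_conv r hc).of_norm.hasSum

theorem norm_conv_le (r : ℤ) (hc : Summable fun j => |c j|) : ‖conv r c‖ ≤ ∑' j, |c j| :=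
  tsum_of_norm_bounded hc.hasSum (norm_smul_shift_le r c)

theorem norm_conv_apply_le (r : ℤ) (hc : Summable fun j => |c j|) (f : EllOne) :
    ‖conv r c f‖ ≤ (∑' j, |c j|) * ‖f‖ :=
  (conv r c).le_of_opNorm_le (norm_conv_le r hc) f

theorem hasSum_conv_apply (r : ℤ) (hc : Summable fun j => |c j|) (f : EllOne) :
    HasSum (fun j : ℕ => c j • shift (r * j) f) (conv r c f) :=
  (hasSum_conv r hc).mapL (ContinuousLinearMap.apply ℝ EllOne f)

theorem hasSum_conv_coord (r : ℤ) (hc : Summable fun j => |c j|) (f : EllOne) (i : ℤ) :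
    HasSum (fun j : ℕ => c j * f (i - r * j)) (conv r c f i) := by
  have h := (hasSum_conv_apply r hc f).mapL (coord i)
  simpa [coord_apply, shift_apply] using h

theorem hasSum_conv_unit (r : ℤ) (hc : Summable fun j => |c j|) (k : ℤ) :
    HasSum (fun j : ℕ => c j • unit (k + r * j)) (conv r c (unit k)) := by
  simpa only [shift_unit] using hasSum_conv_apply r hc (unit k)

/-- All shifts commute, forward and backward alike; hence either factor of `ψ(S⁻¹)ψ(S)` can be
inverted first. -/
theorem conv_comm (q r : ℤ) (c d : ℕ → ℝ) : conv q c * conv r d = conv r d * conv q c := by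
  refine Commute.tsum_left _ fun i => Commute.tsum_right _ fun j => ?_
  refine Commute.smul_left (Commute.smul_right ?_ _) _
  rw [commute_iff_eq, shift_mul, shift_mul, add_comm]

/-- Composition of convolutions in the same direction is the Cauchy product, so a power series
inverse with summable coefficients is an operator inverse. -/
theorem conv_mul_eq_one (r : ℤ) (hc : Summable fun j => |c j|) (hd : Summable fun j => |d j|)
    (hcd : PowerSeries.mk c * PowerSeries.mk d = 1) : conv r c * conv r d = 1 := by
  rw [conv, conv, tsum_mul_tsum_eq_tsum_sum_antidiagonal_of_summable_norm
    (summable_norm_conv r hc) (summable_norm_conv r hd), tsum_eq_single 0]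
  · have h := congr_arg (PowerSeries.coeff 0) hcd
    rw [PowerSeries.coeff_mul] at h
    simp only [Finset.HasAntidiagonal.antidiagonal_zero, Finset.sum_singleton, PowerSeries.coeff_mk,
      PowerSeries.coeff_zero_one] at h
    simp [shift_zero, smul_smul, mul_comm (d 0), h]
  · intro n hn
    have h := congr_arg (PowerSeries.coeff n) hcd
    rw [PowerSeries.coeff_mul, PowerSeries.coeff_one, if_neg hn] at h
    simp only [PowerSeries.coeff_mk] at h
    rw [← zero_smul ℝ (shift (r * n)), ← h, Finset.sum_smul]
    refine Finset.sum_congr rfl fun p hp => ?_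
    rw [smul_mul_smul_comm, shift_mul, ← mul_add, ← Nat.cast_add,
      Finset.HasAntidiagonal.mem_antidiagonal.1 hp]

theorem conv_apply_conv_apply (r : ℤ) (hc : Summable fun j => |c j|)
    (hd : Summable fun j => |d j|) (hcd : PowerSeries.mk c * PowerSeries.mk d = 1) (f : EllOne) :
    conv r c (conv r d f) = f :=
  DFunLike.congr_fun (conv_mul_eq_one r hc hd hcd) f

theorem conv_apply_comm (q r : ℤ) (c d : ℕ → ℝ) (f : EllOne) :
    conv q c (conv r d f) = conv r d (conv q c f) :=
  DFunLike.congr_fun (conv_comm q r c d) f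

theorem conv_apply_eq_zero (hc : Summable fun j => |c j|) {f : EllOne} {i : ℤ}
    (h : ∀ j : ℕ, f (i - r * j) = 0) : conv r c f i = 0 := by
  refine (hasSum_conv_coord r hc f i).unique ?_
  simp [h]

/-- If a shift by at most `n` steps keeps the support of `f` away from `s`, only the tail of `c`
contributes to the restriction of `c * f` to `s`. -/
theorem norm_restrict_conv_le (hc : Summable fun j => |c j|) {f : EllOne} {s : Set ℤ} {n : ℕ}
    (h : ∀ j : ℕ, j ≤ n → ∀ i ∈ s, f (i - r * j) = 0) :
    ‖restrict s (conv r c f)‖ ≤ (∑' j, |c (n + 1 + j)|) * ‖f‖ := by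
  have h1 := (hasSum_conv_apply r hc f).mapL (restrict s)
  have h2 := (hasSum_nat_add_iff' (n + 1)).2 h1
  rw [Finset.sum_eq_zero, sub_zero] at h2
  · have hs : Summable fun j => |c (n + 1 + j)| := by
      simpa only [add_comm] using (summable_nat_add_iff (n + 1)).2 hc
    rw [← h2.tsum_eq]
    refine tsum_of_norm_bounded (hs.hasSum.mul_right ‖f‖) fun j => ?_
    rw [map_smul, norm_smul, Real.norm_eq_abs, add_comm j]
    refine mul_le_mul_of_nonneg_left ((norm_restrict_apply_le _ _).trans ?_) (abs_nonneg _)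
    simpa using (shift (r * ((n + 1 + j : ℕ) : ℤ))).le_of_opNorm_le (norm_shift_le _) f
  · intro j hj
    rw [map_smul, restrict_eq_zero, smul_zero]
    intro i hi
    rw [shift_apply]
    exact h j (Nat.lt_succ_iff.1 (Finset.mem_range.1 hj)) i hi

/-- **Stability of finite sections** in `ℓ¹`: if the Laurent operator with symbol `|ψ|²`,
`ψ` invertible with inverse `π`, applied to `w` vanishes on `[1, n]`, and `w` vanishes on
`(-∞, 0]`, then `w` is controlled by its restriction to `(n, ∞)`. -/
theorem norm_le_of_finite_section {ψ π : ℕ → ℝ} (hψ : Summable fun j => |ψ j|)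
    (hπ : Summable fun j => |π j|) (hψπ : PowerSeries.mk ψ * PowerSeries.mk π = 1)
    (n : ℕ) (w : EllOne) (hw : ∀ k ≤ 0, w k = 0)
    (hz : ∀ l : ℤ, 1 ≤ l → l ≤ n → conv (-1) ψ (conv 1 ψ w) l = 0) {δ : ℝ} (hδ : δ < 1)
    (hn : (∑' j, |ψ j|) ^ 2 * (∑' j, |π j|) * (∑' j, |π (n + 1 + j)|) ≤ δ) :
    ‖w‖ ≤ (∑' j, |ψ j|) ^ 2 * (∑' j, |π j|) ^ 2 / (1 - δ) * ‖restrict (Set.Ioi (n : ℤ)) w‖ := by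
  have hπψ : PowerSeries.mk π * PowerSeries.mk ψ = 1 := by rw [mul_comm, hψπ]
  set a := ∑' j, |ψ j|
  set b := ∑' j, |π j|
  set τ := ∑' j, |π (n + 1 + j)|
  have ha : 0 ≤ a := tsum_nonneg fun _ => abs_nonneg _
  have hb : 0 ≤ b := tsum_nonneg fun _ => abs_nonneg _
  set z := conv (-1) ψ (conv 1 ψ w)
  -- As `z` vanishes on the window, it is the sum of a left part `u` and a right part `v`.
  set u := restrict (Set.Iic 0) z
  set v := restrict (Set.Ioi (n : ℤ)) z
  have hzuv : z = u + v := by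
    ext i
    simp only [u, v, lp.coeFn_add, Pi.add_apply, restrict_apply, Set.mem_Iic, Set.mem_Ioi]
    by_cases h1 : i ≤ 0
    · simp [h1, show ¬ (n : ℤ) < i by omega]
    · by_cases h2 : (n : ℤ) < i
      · simp [h1, h2]
      · simp [h1, h2, hz i (by omega) (by omega)]
  have hu : ∀ i, 0 < i → u i = 0 := fun i hi => by simp [u, restrict_apply, hi]
  have hv : ∀ i, i ≤ (n : ℤ) → v i = 0 := fun i hi => by
    simp [v, restrict_apply, hi]
  have e1 : conv 1 ψ w = conv (-1) π u + conv (-1) π v := by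
    rw [← map_add, ← hzuv, conv_apply_conv_apply _ hπ hψ hπψ]
  have e2 : conv (-1) ψ w = conv 1 π u + conv 1 π v := by
    rw [← map_add, ← hzuv, conv_apply_comm 1 (-1), conv_apply_conv_apply _ hπ hψ hπψ]
  have hA : ∀ i ≤ 0, conv 1 ψ w i = 0 := fun i hi =>
    conv_apply_eq_zero hψ fun j => hw _ (by omega)
  have hBu : ∀ i, 0 < i → conv (-1) π u i = 0 := fun i hi =>
    conv_apply_eq_zero hπ fun j => hu _ (by omega)
  have hBv : ∀ i ≤ (n : ℤ), conv 1 π v i = 0 := fun i hi =>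
    conv_apply_eq_zero hπ fun j => hv _ (by omega)
  -- In `e1`, `ψ(S)w` lives on `(0, ∞)` and `π(S⁻¹)u` on `(-∞, 0]`; restricting to each half-line
  -- separates them.
  have f1 : conv 1 ψ w = restrict (Set.Ioi 0) (conv (-1) π v) := by
    have := congr_arg (restrict (Set.Ioi 0)) e1
    rwa [map_add, restrict_eq_zero (f := conv (-1) π u) (fun i (hi : i ∈ Set.Ioi (0 : ℤ)) => hBu i hi),
      zero_add,
      restrict_eq_self (f := conv 1 ψ w) (fun i hi => hA i (by simpa using hi))] at this
  have f2 : conv (-1) π u = - restrict (Set.Iic 0) (conv (-1) π v) := by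
    have := congr_arg (restrict (Set.Iic 0)) e1
    rw [map_add, restrict_eq_self (f := conv (-1) π u) (fun i hi => hBu i (by simpa using hi)),
      restrict_eq_zero (f := conv 1 ψ w) (fun i (hi : i ∈ Set.Iic (0 : ℤ)) => hA i hi)] at this
    exact eq_neg_of_add_eq_zero_left this.symm
  -- Here `e2` is restricted to `(n, ∞)`. Backward shifts carry nothing from below into this
  -- half-line, so only the entries of `w` beyond `n` enter.
  have f3 : conv 1 π v = restrict (Set.Ioi (n : ℤ)) (conv (-1) ψ (restrict (Set.Ioi (n : ℤ)) w))
      - restrict (Set.Ioi (n : ℤ)) (conv 1 π u) := by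
    have h1 := congr_arg (restrict (Set.Ioi (n : ℤ))) e2
    rw [map_add, restrict_eq_self (f := conv 1 π v) (fun i hi => hBv i (by simpa using hi))] at h1
    have h2 : restrict (Set.Ioi (n : ℤ)) (conv (-1) ψ (w - restrict (Set.Ioi (n : ℤ)) w)) = 0 :=
      restrict_eq_zero fun i hi => conv_apply_eq_zero hψ fun j => by
        have : (n : ℤ) < i - -1 * j := by have : (n : ℤ) < i := hi; omega
        rw [lp.coeFn_sub, Pi.sub_apply, restrict_apply, if_pos (Set.mem_Ioi.2 this), sub_self]
    rw [map_sub, map_sub, sub_eq_zero] at h2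
    rw [← h2, h1, add_sub_cancel_left]
  have g0 : ‖w‖ ≤ b * (b * ‖v‖) := by
    rw [← conv_apply_conv_apply 1 hπ hψ hπψ w, f1]
    exact (norm_conv_apply_le _ hπ _).trans (mul_le_mul_of_nonneg_left
      ((norm_restrict_apply_le _ _).trans (norm_conv_apply_le _ hπ _)) hb)
  have g1 : ‖u‖ ≤ a * (τ * ‖v‖) := by
    rw [← conv_apply_conv_apply (-1) hψ hπ hψπ u, f2]
    refine (norm_conv_apply_le _ hψ _).trans (mul_le_mul_of_nonneg_left ?_ ha)
    rw [norm_neg]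
    -- Source of the smallness: bringing `v` from `(n, ∞)` to `(-∞, 0]` takes more than `n` steps,
    -- so only the tail `τ` of `π` acts.
    exact norm_restrict_conv_le hπ fun j hj i hi => hv _ (by
      have : i ≤ 0 := hi
      omega)
  have g2 : ‖v‖ ≤ a * (a * ‖restrict (Set.Ioi (n : ℤ)) w‖ + b * ‖u‖) := by
    rw [← conv_apply_conv_apply 1 hψ hπ hψπ v, f3]
    refine (norm_conv_apply_le _ hψ _).trans (mul_le_mul_of_nonneg_left ?_ ha)
    refine (norm_sub_le _ _).trans (add_le_add ?_ ?_)
    · exact (norm_restrict_apply_le _ _).trans (norm_conv_apply_le _ hψ _)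
    · exact (norm_restrict_apply_le _ _).trans (norm_conv_apply_le _ hπ _)
  set g := ‖restrict (Set.Ioi (n : ℤ)) w‖
  -- Inserting `g1` into `g2` gives `‖v‖ ≤ a² g + a² b τ ‖v‖`, whose last term is absorbed because
  -- `a² b τ ≤ δ < 1`.
  have g3 : (1 - δ) * ‖v‖ ≤ a ^ 2 * g := by
    have h1 : a * b * ‖u‖ ≤ a * b * (a * (τ * ‖v‖)) :=
      mul_le_mul_of_nonneg_left g1 (mul_nonneg ha hb)
    have h2 : a ^ 2 * b * τ * ‖v‖ ≤ δ * ‖v‖ := mul_le_mul_of_nonneg_right hn (norm_nonneg _)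
    linarith
  have g4 : ‖v‖ ≤ a ^ 2 * g / (1 - δ) := by
    rw [le_div_iff₀ (by linarith)]
    linarith
  calc ‖w‖ ≤ b ^ 2 * ‖v‖ := by linarith
    _ ≤ b ^ 2 * (a ^ 2 * g / (1 - δ)) := mul_le_mul_of_nonneg_left g4 (sq_nonneg _)
    _ = _ := by ring

end EllOne

end LinearPrediction

/-! ### Stationary sequences in a Hilbert space: projections, innovations, Wold decomposition. -/

namespace LinearPrediction

section Hilbert

variable {H : Type*} [NormedAddCommGroup H] [InnerProductSpace ℝ H] {x : ℤ → H}

theorem mem_closedSpan {K : Set ℤ} {k : ℤ} (hk : k ∈ K) : x k ∈ closedSpan x K :=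
  Submodule.le_topologicalClosure _ (Submodule.subset_span ⟨k, hk, rfl⟩)

theorem closedSpan_le {K : Set ℤ} {W : Submodule ℝ H} (hW : IsClosed (W : Set H))
    (h : ∀ k ∈ K, x k ∈ W) : closedSpan x K ≤ W :=
  Submodule.topologicalClosure_minimal _
    (Submodule.span_le.2 (by rintro _ ⟨k, hk, rfl⟩; exact h k hk)) hW

theorem isClosed_closedSpan (K : Set ℤ) : IsClosed (closedSpan x K : Set H) :=
  Submodule.isClosed_topologicalClosure _

theorem closedSpan_mono {K L : Set ℤ} (h : K ⊆ L) : closedSpan x K ≤ closedSpan x L :=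
  closedSpan_le (isClosed_closedSpan L) fun _ hk => mem_closedSpan (h hk)

theorem map_eq_map_of_mem_closedSpan {F : Type*} [NormedAddCommGroup F] [NormedSpace ℝ F]
    {S T : H →L[ℝ] F} {K : Set ℤ} (h : ∀ k ∈ K, S (x k) = T (x k)) {v : H}
    (hv : v ∈ closedSpan x K) : S v = T v := by
  have hle : closedSpan x K ≤ (S - T).ker :=
    closedSpan_le (ContinuousLinearMap.isClosed_ker (S - T)) fun k hk => by
      simp [h k hk]
  have := hle hv
  simpa [sub_eq_zero] using this

theorem inner_eq_zero_of_mem_closedSpan {K : Set ℤ} {y v : H} (h : ∀ k ∈ K, inner ℝ y (x k) = 0)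
    (hv : v ∈ closedSpan x K) : inner ℝ y v = 0 := by
  have := map_eq_map_of_mem_closedSpan (S := innerSL ℝ y) (T := 0) (K := K)
    (by simpa using h) hv
  simpa using this

/-- A process whose Gram matrix is shift invariant. -/
def IsGramStationary (x : ℤ → H) : Prop :=
  ∀ s t h : ℤ, inner ℝ (x (s + h)) (x (t + h)) = (inner ℝ (x s) (x t) : ℝ)

theorem IsGramStationary.norm_linearCombination (hx : IsGramStationary x) (h : ℤ) (c : ℤ →₀ ℝ) :
    ‖Finsupp.linearCombination ℝ (fun t => x (t + h)) c‖ = ‖Finsupp.linearCombination ℝ x c‖ := by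
  rw [← sq_eq_sq₀ (norm_nonneg _) (norm_nonneg _), ← real_inner_self_eq_norm_sq,
    ← real_inner_self_eq_norm_sq]
  simp only [Finsupp.linearCombination_apply, Finsupp.sum, sum_inner, inner_sum, inner_smul_left,
    inner_smul_right, hx _ _ h]

/-- The identity holds on the generators and extends by continuity, one argument at a time. -/
theorem IsGramStationary.inner_shift (hx : IsGramStationary x) {h : ℤ} {T : H →L[ℝ] H}
    (hT : ∀ t, T (x t) = x (t + h)) {v w : H} (hv : v ∈ closedSpan x Set.univ)
    (hw : w ∈ closedSpan x Set.univ) : inner ℝ (T v) (T w) = (inner ℝ v w : ℝ) := by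
  have h1 : ∀ k, inner ℝ (x (k + h)) (T v) = (inner ℝ (x k) v : ℝ) := fun k =>
    map_eq_map_of_mem_closedSpan (S := (innerSL ℝ (x (k + h))).comp T) (T := innerSL ℝ (x k))
      (K := Set.univ) (fun j _ => by simp [hT, hx _ _ h]) hv
  refine map_eq_map_of_mem_closedSpan (S := (innerSL ℝ (T v)).comp T) (T := innerSL ℝ v)
    (K := Set.univ) (fun j _ => ?_) hw
  have := h1 j
  rw [real_inner_comm, real_inner_comm _ (x j)] at this
  simpa [hT] using this

variable [CompleteSpace H]

theorem proj_mem (K : Set ℤ) (y : H) : proj x K y ∈ closedSpan x K :=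
  Submodule.starProjection_apply_mem (Submodule.span ℝ (x '' K)).topologicalClosure y

theorem inner_sub_proj {K : Set ℤ} {y v : H} (hv : v ∈ closedSpan x K) :
    inner ℝ (y - proj x K y) v = 0 :=
  Submodule.starProjection_inner_eq_zero _ _ hv

theorem proj_eq {K : Set ℤ} {y v : H} (hv : v ∈ closedSpan x K)
    (h : ∀ k ∈ K, inner ℝ (y - v) (x k) = 0) : proj x K y = v :=
  Submodule.eq_starProjection_of_mem_orthogonal hv
    ((Submodule.mem_orthogonal' _ _).2 fun _ hw => inner_eq_zero_of_mem_closedSpan h hw)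

theorem proj_of_mem {K : Set ℤ} {y : H} (hy : y ∈ closedSpan x K) : proj x K y = y :=
  proj_eq hy (by simp)

theorem proj_of_inner_eq_zero {K : Set ℤ} {y : H} (h : ∀ k ∈ K, inner ℝ y (x k) = 0) :
    proj x K y = 0 :=
  proj_eq (zero_mem _) (by simpa using h)

theorem innovation_mem (t : ℤ) : innovation x t ∈ closedSpan x (Set.Iic t) :=
  Submodule.sub_mem _ (mem_closedSpan (Set.mem_Iic.2 le_rfl))
    (closedSpan_mono (Set.Iic_subset_Iic.2 (by omega)) (proj_mem _ _))

theorem inner_innovation_of_mem {t : ℤ} {v : H} (hv : v ∈ closedSpan x (Set.Iic (t - 1))) :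
    inner ℝ (innovation x t) v = 0 :=
  inner_sub_proj hv

theorem inner_innovation_of_lt {s t : ℤ} (h : s < t) : inner ℝ (innovation x t) (x s) = 0 :=
  inner_innovation_of_mem (mem_closedSpan (Set.mem_Iic.2 (by omega)))

theorem inner_innovation_self (t : ℤ) :
    inner ℝ (innovation x t) (x t) = ‖innovation x t‖ ^ 2 := by
  have h : x t = innovation x t + proj x (Set.Iic (t - 1)) (x t) := by simp [innovation]
  conv_lhs => rw [h, inner_add_right, inner_innovation_of_mem (proj_mem _ _), add_zero,
    real_inner_self_eq_norm_sq]

theorem inner_innovation_innovation {s t : ℤ} (h : s ≠ t) :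
    inner ℝ (innovation x s) (innovation x t) = 0 := by
  wlog hst : t < s generalizing s t
  · rw [real_inner_comm]
    exact this h.symm (by omega)
  · exact inner_innovation_of_mem
      (closedSpan_mono (Set.Iic_subset_Iic.2 (by omega)) (innovation_mem t))

/-- `V_{(-∞, s]}` is the orthogonal sum of `V_{(-∞, s-1]}` and the line of the innovation at `s`. If
that innovation is zero, the added term is zero. -/
theorem proj_Iic_eq (s : ℤ) (y : H) : proj x (Set.Iic s) y = proj x (Set.Iic (s - 1)) y +
    (inner ℝ y (innovation x s) / ‖innovation x s‖ ^ 2) • innovation x s := by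
  have hmono : closedSpan x (Set.Iic (s - 1)) ≤ closedSpan x (Set.Iic s) :=
    closedSpan_mono (Set.Iic_subset_Iic.2 (by omega))
  set c := inner ℝ y (innovation x s) / ‖innovation x s‖ ^ 2 with hc
  set p := proj x (Set.Iic (s - 1)) y
  refine proj_eq (Submodule.add_mem _ (hmono (proj_mem _ _))
    (Submodule.smul_mem _ _ (innovation_mem s))) ?_
  have hlt : ∀ v ∈ closedSpan x (Set.Iic (s - 1)),
      inner ℝ (y - (p + c • innovation x s)) v = 0 := by
    intro v hv
    rw [← sub_sub, inner_sub_left, inner_smul_left, inner_innovation_of_mem hv,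
      inner_sub_proj hv]
    simp
  have hinn : inner ℝ (y - (p + c • innovation x s)) (innovation x s) = 0 := by
    rw [inner_sub_left, inner_add_left, inner_smul_left, real_inner_comm _ p,
      inner_innovation_of_mem (proj_mem _ _), real_inner_self_eq_norm_sq]
    by_cases h0 : innovation x s = 0
    · simp [h0]
    · have : ‖innovation x s‖ ^ 2 ≠ 0 := by simpa using h0
      simp only [conj_trivial, hc]
      field_simp
      simp
  intro k hk
  rcases (Set.mem_Iic.1 hk).lt_or_eq with h | rfl
  · exact hlt _ (mem_closedSpan (Set.mem_Iic.2 (by omega)))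
  · have h : x k = innovation x k + proj x (Set.Iic (k - 1)) (x k) := by simp [innovation]
    rw [h, inner_add_right, hinn, hlt _ (proj_mem _ _), add_zero]

/-- Stationarity makes `x t ↦ x (t + h)` norm preserving on finite combinations, hence well defined
there. It extends by density to the closed span, and to `H` through the orthogonal projection. It
serves to carry innovations and MA coefficients from one time to another. -/
theorem IsGramStationary.exists_shift (hx : IsGramStationary x) (h : ℤ) :
    ∃ T : H →L[ℝ] H, ∀ t, T (x t) = x (t + h) := by
  set V := closedSpan x Set.univ
  have : CompleteSpace V := (isClosed_closedSpan Set.univ).completeSpace_coe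
  have hmem : ∀ c, Finsupp.linearCombination ℝ x c ∈ V := fun c => by
    rw [Finsupp.linearCombination_apply]
    exact Submodule.sum_mem _ fun i _ => Submodule.smul_mem _ _ (mem_closedSpan (Set.mem_univ i))
  let e : (ℤ →₀ ℝ) →ₗ[ℝ] V := (Finsupp.linearCombination ℝ x).codRestrict V hmem
  let f : (ℤ →₀ ℝ) →ₗ[ℝ] H := Finsupp.linearCombination ℝ fun t => x (t + h)
  have hdense : DenseRange e := by
    intro v
    rw [closure_subtype]
    have hv : (v : H) ∈ closure (Submodule.span ℝ (x '' Set.univ) : Set H) := v.2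
    refine closure_mono ?_ hv
    intro y hy
    rw [Set.image_univ, SetLike.mem_coe, Finsupp.mem_span_range_iff_exists_finsupp] at hy
    obtain ⟨c, rfl⟩ := hy
    exact ⟨e c, ⟨c, rfl⟩, by simp [e, Finsupp.linearCombination_apply]⟩
  have hnorm : ∃ C, ∀ c, ‖f c‖ ≤ C * ‖e c‖ :=
    ⟨1, fun c => by rw [one_mul]; exact (hx.norm_linearCombination h c).le⟩
  refine ⟨(f.extendOfNorm e).comp V.orthogonalProjectionOnto, fun t => ?_⟩
  have h1 : V.orthogonalProjectionOnto (x t) = e (Finsupp.single t 1) := by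
    ext
    rw [Submodule.coe_orthogonalProjectionOnto_apply]
    have h2 : V.starProjection (x t) = x t := proj_of_mem (mem_closedSpan (Set.mem_univ t))
    simpa [e] using h2
  rw [ContinuousLinearMap.comp_apply, h1, LinearMap.extendOfNorm_eq hdense hnorm]
  simp [f]

theorem IsGramStationary.shift_innovation (hx : IsGramStationary x) {h : ℤ} {T : H →L[ℝ] H}
    (hT : ∀ t, T (x t) = x (t + h)) (t : ℤ) : T (innovation x t) = innovation x (t + h) := by
  have huniv : ∀ K : Set ℤ, closedSpan x K ≤ closedSpan x Set.univ := fun K =>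
    closedSpan_mono (Set.subset_univ K)
  -- `T` maps the past of `t` into the past of `t + h` and preserves orthogonality, so it
  -- intertwines the two projections.
  have key : proj x (Set.Iic (t + h - 1)) (x (t + h)) = T (proj x (Set.Iic (t - 1)) (x t)) := by
    refine proj_eq ?_ fun k hk => ?_
    · have hle : closedSpan x (Set.Iic (t - 1)) ≤
          (closedSpan x (Set.Iic (t + h - 1))).comap (T : H →ₗ[ℝ] H) :=
        closedSpan_le ((isClosed_closedSpan _).preimage T.continuous) fun k hk => by
          have hk' : k ≤ t - 1 := hk
          simp only [Submodule.mem_comap, ContinuousLinearMap.coe_coe, hT]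
          exact mem_closedSpan (Set.mem_Iic.2 (by omega))
      exact hle (proj_mem _ _)
    · have hk' : k ≤ t + h - 1 := hk
      have := hx.inner_shift hT (v := innovation x t) (w := x (k - h))
        (huniv _ (innovation_mem t)) (mem_closedSpan (Set.mem_univ _))
      rw [inner_innovation_of_lt (by omega), hT, sub_add_cancel, innovation, map_sub, hT] at this
      exact this
  rw [innovation, map_sub, hT, ← key, innovation]

theorem IsGramStationary.norm_innovation (hx : IsGramStationary x) (t : ℤ) :
    ‖innovation x t‖ = ‖innovation x 0‖ := by
  obtain ⟨T, hT⟩ := hx.exists_shift t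
  have hm := closedSpan_mono (Set.subset_univ _) (innovation_mem (x := x) 0)
  have := hx.inner_shift hT hm hm
  rw [hx.shift_innovation hT, zero_add, real_inner_self_eq_norm_sq,
    real_inner_self_eq_norm_sq] at this
  exact (sq_eq_sq₀ (norm_nonneg _) (norm_nonneg _)).1 this

theorem IsGramStationary.maCoeff_eq (hx : IsGramStationary x) (t : ℤ) (j : ℕ) :
    inner ℝ (x t) (innovation x (t - j)) / ‖innovation x (t - j)‖ ^ 2 = maCoeff x j := by
  obtain ⟨T, hT⟩ := hx.exists_shift t
  have := hx.inner_shift hT (v := x 0) (w := innovation x (-(j : ℤ)))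
    (mem_closedSpan (Set.mem_univ _)) (closedSpan_mono (Set.subset_univ _) (innovation_mem _))
  rw [hT, hx.shift_innovation hT, zero_add, neg_add_eq_sub] at this
  rw [this, hx.norm_innovation, maCoeff]

theorem IsGramStationary.eq_sum_add_proj (hx : IsGramStationary x) (t : ℤ) (N : ℕ) :
    x t = ∑ j ∈ Finset.range N, maCoeff x j • innovation x (t - j) +
      proj x (Set.Iic (t - N)) (x t) := by
  induction N with
  | zero => simpa using (proj_of_mem (mem_closedSpan (Set.mem_Iic.2 le_rfl))).symm
  | succ N ih =>
    rw [proj_Iic_eq, hx.maCoeff_eq] at ih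
    rw [Finset.sum_range_succ, add_assoc, Nat.cast_succ, ← sub_sub]
    conv_lhs => rw [ih]
    abel

/-- The **Wold decomposition** of a purely nondeterministic process with summable
moving average coefficients. -/
theorem IsGramStationary.hasSum_wold (hx : IsGramStationary x) (hp : IsPurelyNondeterministic x)
    (hψ : Summable fun j => |maCoeff x j|) (t : ℤ) :
    HasSum (fun j : ℕ => maCoeff x j • innovation x (t - j)) (x t) := by
  have hs : Summable fun j : ℕ => maCoeff x j • innovation x (t - j) := by
    refine Summable.of_norm_bounded (hψ.mul_right ‖innovation x 0‖) fun j => ?_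
    rw [norm_smul, hx.norm_innovation, Real.norm_eq_abs]
  -- Absolute convergence of the series forces the remainders to converge; their limit lies in every
  -- `V_{(-∞, n]}`, hence is zero.
  have hlim : Tendsto (fun N : ℕ => proj x (Set.Iic (t - N)) (x t)) atTop
      (𝓝 (x t - ∑' j : ℕ, maCoeff x j • innovation x (t - j))) := by
    refine (tendsto_const_nhds.sub hs.hasSum.tendsto_sum_nat).congr fun N => ?_
    rw [sub_eq_iff_eq_add']
    exact hx.eq_sum_add_proj t N
  have hmem : x t - ∑' j : ℕ, maCoeff x j • innovation x (t - j) ∈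
      ⨅ n : ℤ, closedSpan x (Set.Iic n) := by
    refine Submodule.mem_iInf _ |>.2 fun n => ?_
    refine (isClosed_closedSpan (Set.Iic n)).mem_of_tendsto hlim ?_
    filter_upwards [eventually_ge_atTop (t - n).toNat] with N hN
    exact closedSpan_mono (Set.Iic_subset_Iic.2 (by omega)) (proj_mem _ _)
  rw [show (⨅ n : ℤ, closedSpan x (Set.Iic n)) = ⊥ from hp, Submodule.mem_bot, sub_eq_zero] at hmem
  exact hmem ▸ hs.hasSum

/-- The standing assumptions of the prediction theory: a stationary, nonzero, purely
nondeterministic sequence with summable MA and AR coefficients. -/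
structure IsRegular (x : ℤ → H) : Prop where
  gram : IsGramStationary x
  pnd : IsPurelyNondeterministic x
  ne_zero : x 0 ≠ 0
  summable_ma : Summable fun j => |maCoeff x j|
  summable_ar : Summable fun j => |arCoeff x j|

namespace IsRegular

variable (hx : IsRegular x)
include hx

theorem innovation_ne_zero : innovation x 0 ≠ 0 := by
  intro h0
  have h := hx.gram.hasSum_wold hx.pnd hx.summable_ma 0
  have hz : ∀ t, innovation x t = 0 := fun t => by
    rw [← norm_eq_zero, hx.gram.norm_innovation, h0, norm_zero]
  simp only [hz, smul_zero] at h
  exact hx.ne_zero (h.unique hasSum_zero)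

theorem norm_innovation_sq_ne_zero : ‖innovation x 0‖ ^ 2 ≠ 0 := by
  simpa using hx.innovation_ne_zero

theorem maCoeff_zero : maCoeff x 0 = 1 := by
  have h := inner_innovation_self (x := x) 0
  rw [real_inner_comm] at h
  rw [maCoeff, Nat.cast_zero, neg_zero, h, div_self hx.norm_innovation_sq_ne_zero]

end IsRegular

/-! ### Predictor coefficients in `ℓ¹(ℤ)` coordinates. -/

/-- The power series coefficients of `1 / ψ`. -/
noncomputable def invMaCoeff (x : ℤ → H) (j : ℕ) : ℝ := -arCoeff x j

theorem abs_invMaCoeff (j : ℕ) : |invMaCoeff x j| = |arCoeff x j| := abs_neg _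

/-- The `m`-step ahead infinite predictor coefficients as an element of `ℓ¹(ℤ)`. -/
noncomputable def infPredSeq (x : ℤ → H) (m : ℕ) : EllOne :=
  EllOne.conv 1 (invMaCoeff x)
    (EllOne.restrict (Set.Ici 1) (EllOne.conv 1 (maCoeff x) (EllOne.unit (1 - m))))

namespace IsRegular

variable (hx : IsRegular x)
include hx

theorem summable_inv : Summable fun j => |invMaCoeff x j| := by
  simpa only [abs_invMaCoeff] using hx.summable_ar

theorem mk_mul_mk : PowerSeries.mk (maCoeff x) * PowerSeries.mk (invMaCoeff x) = 1 := by
  have h : PowerSeries.mk (invMaCoeff x) = (PowerSeries.mk (maCoeff x))⁻¹ := by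
    ext j
    simp [invMaCoeff, arCoeff]
  rw [h]
  refine PowerSeries.mul_inv_cancel _ ?_
  rw [← PowerSeries.coeff_zero_eq_constantCoeff_apply, PowerSeries.coeff_mk, hx.maCoeff_zero]
  exact one_ne_zero

theorem mk_mul_mk' : PowerSeries.mk (invMaCoeff x) * PowerSeries.mk (maCoeff x) = 1 := by
  rw [mul_comm, hx.mk_mul_mk]

/-- Synthesis from innovations: `f ↦ ∑ᵢ fᵢ ε_{n+1-i}`. -/
noncomputable def synth (n : ℤ) : EllOne →L[ℝ] H :=
  EllOne.lift (fun i => innovation x (n + 1 - i)) ‖innovation x 0‖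
    fun _ => (hx.gram.norm_innovation _).le

theorem synth_unit (n k : ℤ) : hx.synth n (EllOne.unit k) = innovation x (n + 1 - k) :=
  EllOne.lift_unit _ _ _ k

theorem synth_conv_unit (n k : ℤ) :
    hx.synth n (EllOne.conv 1 (maCoeff x) (EllOne.unit k)) = x (n + 1 - k) := by
  have h := (EllOne.hasSum_conv_unit 1 hx.summable_ma k).mapL (hx.synth n)
  refine h.unique ?_
  convert hx.gram.hasSum_wold hx.pnd hx.summable_ma (n + 1 - k) using 2 with j
  rw [map_smul, hx.synth_unit]
  congr 2
  ring

theorem hasSum_synth_conv (n : ℤ) (f : EllOne) :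
    HasSum (fun k => f k • x (n + 1 - k)) (hx.synth n (EllOne.conv 1 (maCoeff x) f)) := by
  have h := (EllOne.hasSum_unit f).mapL ((hx.synth n).comp (EllOne.conv 1 (maCoeff x)))
  simpa [hx.synth_conv_unit] using h

/-- Indices `k ≥ 1` carry innovations at times at most `n`, which lie in the past; indices `k ≤ 0`
carry later ones, which are orthogonal to it. -/
theorem proj_synth (n : ℤ) (f : EllOne) :
    proj x (Set.Iic n) (hx.synth n f) = hx.synth n (EllOne.restrict (Set.Ici 1) f) := by
  have : ((Submodule.span ℝ (x '' Set.Iic n)).topologicalClosure.starProjection).comp (hx.synth n) =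
      (hx.synth n).comp (EllOne.restrict (Set.Ici 1)) := EllOne.ext_unit fun k => by
    simp only [ContinuousLinearMap.comp_apply, EllOne.restrict_unit, Set.mem_Ici]
    change proj x (Set.Iic n) (hx.synth n (EllOne.unit k)) = _
    split_ifs with hk
    · rw [hx.synth_unit]
      exact proj_of_mem (closedSpan_mono (Set.Iic_subset_Iic.2 (by omega)) (innovation_mem _))
    · rw [hx.synth_unit, map_zero]
      refine proj_of_inner_eq_zero fun j hj => inner_innovation_of_lt ?_
      have : j ≤ n := hj
      omega
  exact DFunLike.congr_fun this f

theorem inner_innovation_synth (n i : ℤ) (f : EllOne) :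
    inner ℝ (innovation x (n + 1 - i)) (hx.synth n f) = ‖innovation x 0‖ ^ 2 * f i := by
  have : (innerSL ℝ (innovation x (n + 1 - i))).comp (hx.synth n) =
      ‖innovation x 0‖ ^ 2 • EllOne.coord i := EllOne.ext_unit fun k => by
    simp only [ContinuousLinearMap.comp_apply, hx.synth_unit, innerSL_apply_apply,
      smul_apply, EllOne.coord_apply, EllOne.unit_apply]
    split_ifs with hik
    · rw [hik, real_inner_self_eq_norm_sq, hx.gram.norm_innovation]
      simp
    · rw [inner_innovation_innovation (by omega)]
      simp
  exact DFunLike.congr_fun this f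

/-- Applied to `conv 1 (maCoeff x) w`, this expresses the normal equations through the Laurent
operator `ψ(S⁻¹)ψ(S)`. -/
theorem inner_synth (n l : ℤ) (f : EllOne) :
    inner ℝ (x (n + 1 - l)) (hx.synth n f) =
      ‖innovation x 0‖ ^ 2 * EllOne.conv (-1) (maCoeff x) f l := by
  have h1 := (hx.gram.hasSum_wold hx.pnd hx.summable_ma (n + 1 - l)).mapL
    (innerSL ℝ (hx.synth n f))
  have h2 := (EllOne.hasSum_conv_coord (-1) hx.summable_ma f l).mul_left (‖innovation x 0‖ ^ 2)
  simp only [innerSL_apply_apply] at h1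
  rw [real_inner_comm]
  refine h1.unique (h2.congr_fun fun j => ?_)
  rw [inner_smul_right, real_inner_comm, sub_sub, hx.inner_innovation_synth]
  rw [show l - -1 * (j : ℤ) = l + j by ring]
  ring

theorem infPredSeq_apply_of_le {m : ℕ} {k : ℤ} (hk : k ≤ 0) : infPredSeq x m k = 0 := by
  refine EllOne.conv_apply_eq_zero hx.summable_inv fun j => ?_
  rw [EllOne.restrict_apply, if_neg]
  simp only [Set.mem_Ici]
  omega

theorem synth_conv_infPredSeq (n : ℤ) (m : ℕ) :
    hx.synth n (EllOne.conv 1 (maCoeff x) (infPredSeq x m)) = proj x (Set.Iic n) (x (n + m)) := by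
  rw [infPredSeq, EllOne.conv_apply_conv_apply 1 hx.summable_ma hx.summable_inv hx.mk_mul_mk,
    ← hx.proj_synth, hx.synth_conv_unit]
  congr 2
  ring

theorem isInfPredictor_infPredSeq (m : ℕ) : IsInfPredictor x m fun k => infPredSeq x m k := by
  intro n
  have h := hx.hasSum_synth_conv n (infPredSeq x m)
  rw [hx.synth_conv_infPredSeq] at h
  have hinj : Function.Injective fun k : ℕ => (k : ℤ) + 1 := fun a b hab => by simpa using hab
  have h' := (hinj.hasSum_iff (fun k hk => by
    rw [hx.infPredSeq_apply_of_le, zero_smul]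
    by_contra! hk0
    exact hk ⟨(k - 1).toNat, by simp; omega⟩)).2 h
  refine h'.tendsto_sum_nat.congr fun N => ?_
  rw [← Finset.Ico_add_one_right_eq_Icc, Finset.sum_Ico_eq_sum_range, Nat.add_sub_cancel]
  refine Finset.sum_congr rfl fun k _ => ?_
  simp only [Function.comp_apply, Nat.cast_add, Nat.cast_one, add_comm (1 : ℤ)]

/-- Uniqueness identifies the coefficients chosen by `Classical.epsilon` with `infPredSeq`. Pairing
with the innovation at time `1 - k` kills the indices above `k`, which are earlier times; those
below `k` vanish by induction. -/
theorem coeff_unique {m : ℕ} {a b : ℕ → ℝ} (ha : IsInfPredictor x m a) (hb : IsInfPredictor x m b)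
    {k : ℕ} (hk : 1 ≤ k) : a k = b k := by
  induction k using Nat.strong_induction_on with
  | _ k ih =>
    have hlim := ((ha 0).sub (hb 0)).inner (𝕜 := ℝ) (tendsto_const_nhds (x := innovation x (1 - k)))
    rw [sub_self, inner_zero_left] at hlim
    have hev : ∀ᶠ N : ℕ in atTop, inner ℝ (∑ l ∈ Finset.Icc 1 N, a l • x (0 + 1 - l) -
        ∑ l ∈ Finset.Icc 1 N, b l • x (0 + 1 - l)) (innovation x (1 - k)) =
        (a k - b k) * ‖innovation x 0‖ ^ 2 := by
      filter_upwards [eventually_ge_atTop k] with N hN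
      rw [← Finset.sum_sub_distrib, sum_inner, Finset.sum_eq_single_of_mem k
        (Finset.mem_Icc.2 ⟨hk, hN⟩)]
      · rw [← sub_smul, inner_smul_left, zero_add, real_inner_comm, inner_innovation_self,
          hx.gram.norm_innovation]
        simp
      · intro l hl hlk
        rcases lt_or_gt_of_ne hlk with h | h
        · rw [ih l h (Finset.mem_Icc.1 hl).1, sub_self, inner_zero_left]
        · rw [← sub_smul, inner_smul_left, real_inner_comm, inner_innovation_of_lt (by omega),
            mul_zero]
    have h0 := tendsto_nhds_unique (tendsto_const_nhds.congr' (hev.mono fun _ h => h.symm)) hlim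
    exact sub_eq_zero.1 ((mul_eq_zero.1 h0).resolve_right hx.norm_innovation_sq_ne_zero)

theorem infPredCoeff_eq (m : ℕ) {k : ℕ} (hk : 1 ≤ k) :
    infPredCoeff x m k = infPredSeq x m k :=
  hx.coeff_unique (Classical.epsilon_spec ⟨_, hx.isInfPredictor_infPredSeq m⟩)
    (hx.isInfPredictor_infPredSeq m) hk

end IsRegular

/-- A finite span is already closed. Existence suffices, as Baxter's inequality is proved for
whichever solution is chosen. -/
theorem exists_isFinPredictor (x : ℤ → H) (m n : ℕ) : ∃ a, IsFinPredictor x m n a := by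
  set K : Set ℤ := Set.Icc 1 (n : ℤ)
  have hfin : (x '' K).Finite := (Set.finite_Icc _ _).image x
  have : FiniteDimensional ℝ (Submodule.span ℝ (x '' K)) := FiniteDimensional.span_of_finite ℝ hfin
  have hmem : proj x K (x (n + m)) ∈ Submodule.span ℝ (x '' K) := by
    have h := proj_mem (x := x) K (x (n + m))
    rwa [closedSpan, (Submodule.closed_of_finiteDimensional _).submodule_topologicalClosure_eq] at h
  have himg : x '' K = (fun k : ℕ => x ((n : ℤ) + 1 - k)) '' (Finset.Icc 1 n : Finset ℕ) := by
    ext y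
    constructor
    · rintro ⟨k, ⟨h1, h2⟩, rfl⟩
      refine ⟨(n + 1 - k).toNat, ?_, ?_⟩
      · simp only [Finset.coe_Icc, Set.mem_Icc]; omega
      · dsimp only
        congr 1; omega
    · rintro ⟨k, hk, rfl⟩
      simp only [Finset.coe_Icc, Set.mem_Icc] at hk
      exact ⟨(n : ℤ) + 1 - k, ⟨by omega, by omega⟩, rfl⟩
  rw [himg, Submodule.mem_span_image_finset_iff_exists_fun'] at hmem
  exact hmem

/-! ### Baxter's inequality and the tail of the predictor. -/

namespace IsRegular

variable (hx : IsRegular x)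
include hx

theorem predTail_eq (m n : ℕ) :
    predTail x m n = ‖EllOne.restrict (Set.Ioi (n : ℤ)) (infPredSeq x m)‖ := by
  have hinj : Function.Injective fun k : ℕ => (n : ℤ) + 1 + k := fun a b hab => by simpa using hab
  have h := (hinj.hasSum_iff (fun k hk => by
    rw [EllOne.restrict_apply, if_neg, abs_zero]
    intro hk0
    have : (n : ℤ) < k := hk0
    exact hk ⟨(k - 1 - n).toNat, by simp; omega⟩)).2
      (EllOne.hasSum_norm (EllOne.restrict (Set.Ioi (n : ℤ)) (infPredSeq x m)))
  rw [predTail, ← h.tsum_eq]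
  refine tsum_congr fun k => ?_
  rw [hx.infPredCoeff_eq m (by omega), Function.comp_apply, EllOne.restrict_apply, if_pos]
  · push_cast; rfl
  · simp only [Set.mem_Ioi]; omega

theorem summable_abs_infPredCoeff (m : ℕ) : Summable fun k => |infPredCoeff x m k| := by
  -- The entry at index `0` is an arbitrary choice, so it is split off.
  rw [← summable_nat_add_iff 1]
  have hinj : Function.Injective fun k : ℕ => (k : ℤ) + 1 := fun a b hab => by simpa using hab
  refine ((EllOne.summable_abs (infPredSeq x m)).comp_injective hinj).congr fun k => ?_
  rw [hx.infPredCoeff_eq m (by omega)]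
  simp

/-- **Baxter's inequality** for `m`-step ahead predictors. -/
theorem baxter {n : ℕ} {δ : ℝ} (hδ : δ < 1)
    (hn : (∑' j, |maCoeff x j|) ^ 2 * (∑' j, |arCoeff x j|) * (∑' j, |arCoeff x (n + 1 + j)|) ≤ δ)
    (m : ℕ) :
    ∑ k ∈ Finset.Icc 1 n, |infPredCoeff x m k - finPredCoeff x m n k| ≤
      (∑' j, |maCoeff x j|) ^ 2 * (∑' j, |arCoeff x j|) ^ 2 / (1 - δ) * predTail x m n := by
  have hb : IsFinPredictor x m n (finPredCoeff x m n) :=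
    Classical.epsilon_spec (exists_isFinPredictor x m n)
  set b := finPredCoeff x m n
  set d : EllOne := ∑ k ∈ Finset.Icc 1 n, b k • EllOne.unit k
  have hd : ∀ i : ℤ, d i = ∑ k ∈ Finset.Icc 1 n, b k * if i = k then 1 else 0 := fun i => by
    rw [← EllOne.coord_apply, map_sum]
    simp only [map_smul, EllOne.coord_apply, EllOne.unit_apply, smul_eq_mul]
  have hd_nat : ∀ k ∈ Finset.Icc 1 n, d (k : ℕ) = b k := fun k hk => by
    rw [hd, Finset.sum_eq_single_of_mem k hk]
    · simp
    · intro l _ hl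
      rw [if_neg (by exact_mod_cast hl.symm), mul_zero]
  have hd_zero : ∀ i : ℤ, (i ≤ 0 ∨ (n : ℤ) < i) → d i = 0 := fun i hi => by
    rw [hd]
    refine Finset.sum_eq_zero fun k hk => ?_
    have := Finset.mem_Icc.1 hk
    rw [if_neg (by omega), mul_zero]
  set w := d - infPredSeq x m
  have hsynth : hx.synth n (EllOne.conv 1 (maCoeff x) w) =
      proj x (Set.Icc 1 (n : ℤ)) (x (n + m)) - proj x (Set.Iic (n : ℤ)) (x (n + m)) := by
    rw [map_sub, map_sub, hx.synth_conv_infPredSeq, map_sum, map_sum, ← hb]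
    simp only [map_smul, hx.synth_conv_unit]
  have hw : ∀ k ≤ 0, w k = 0 := fun k hk => by
    simp [w, hd_zero k (Or.inl hk), hx.infPredSeq_apply_of_le hk]
  -- Both prediction errors are orthogonal to `x_1, …, x_n`, hence so is their difference, which is
  -- the synthesis of `w`.
  have hz : ∀ l : ℤ, 1 ≤ l → l ≤ n →
      EllOne.conv (-1) (maCoeff x) (EllOne.conv 1 (maCoeff x) w) l = 0 := by
    intro l h1 h2
    have h := hx.inner_synth n l (EllOne.conv 1 (maCoeff x) w)
    have e1 : inner ℝ (x (n + m) - proj x (Set.Icc 1 (n : ℤ)) (x (n + m))) (x (n + 1 - l)) = 0 :=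
      inner_sub_proj (mem_closedSpan (Set.mem_Icc.2 ⟨by omega, by omega⟩))
    have e2 : inner ℝ (x (n + m) - proj x (Set.Iic (n : ℤ)) (x (n + m))) (x (n + 1 - l)) = 0 :=
      inner_sub_proj (mem_closedSpan (Set.mem_Iic.2 (by omega)))
    rw [hsynth, real_inner_comm, ← sub_sub_sub_cancel_left _ _ (x (n + m)), inner_sub_left,
      e1, e2, sub_self] at h
    exact (mul_eq_zero.1 h.symm).resolve_left hx.norm_innovation_sq_ne_zero
  have hsec := EllOne.norm_le_of_finite_section hx.summable_ma hx.summable_inv hx.mk_mul_mk n w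
    hw hz hδ (by simpa only [abs_invMaCoeff] using hn)
  simp only [abs_invMaCoeff] at hsec
  have htail : ‖EllOne.restrict (Set.Ioi (n : ℤ)) w‖ = predTail x m n := by
    rw [hx.predTail_eq, map_sub, EllOne.restrict_eq_zero (f := d) fun i (hi : i ∈ Set.Ioi (n : ℤ)) =>
      hd_zero i (Or.inr hi),
      zero_sub, norm_neg]
  rw [htail] at hsec
  refine le_trans ?_ hsec
  have hinj : Function.Injective fun k : ℕ => (k : ℤ) := Nat.cast_injective
  have hsum := (EllOne.summable_abs w).sum_le_tsum ((Finset.Icc 1 n).map ⟨_, hinj⟩)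
    fun _ _ => abs_nonneg _
  rw [← EllOne.norm_eq_tsum, Finset.sum_map] at hsum
  refine le_trans (le_of_eq (Finset.sum_congr rfl fun k hk => ?_)) hsum
  rw [hx.infPredCoeff_eq m (Finset.mem_Icc.1 hk).1, abs_sub_comm]
  simp [w, hd_nat k hk]

/-- The tail of the `m + 1`-step predictor is a convolution of `ψ` with the tails of `φ`. -/
theorem predTail_succ_le (m n : ℕ) : predTail x (m + 1) n ≤
    ∑ l ∈ Finset.range (m + 1), |maCoeff x l| * ∑' j, |arCoeff x (n + (m - l) + 1 + j)| := by
  set k : ℤ := 1 - ((m + 1 : ℕ) : ℤ)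
  set q := EllOne.restrict (Set.Iio 1) (EllOne.conv 1 (maCoeff x) (EllOne.unit k))
  have hq : q = ∑ l ∈ Finset.range (m + 1), maCoeff x l • EllOne.unit (k + l) := by
    have h := (EllOne.hasSum_conv_unit 1 hx.summable_ma k).mapL (EllOne.restrict (Set.Iio 1))
    change HasSum _ q at h
    rw [← h.tsum_eq, tsum_eq_sum (s := Finset.range (m + 1))]
    · refine Finset.sum_congr rfl fun l hl => ?_
      have := Finset.mem_range.1 hl
      rw [map_smul, EllOne.restrict_unit, one_mul, if_pos]
      simp only [Set.mem_Iio]; omega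
    · intro l hl
      rw [Finset.mem_range] at hl
      rw [map_smul, EllOne.restrict_unit, if_neg, smul_zero]
      simp only [Set.mem_Iio]; omega
  -- Passing to the complementary restriction replaces an infinite series by the finite sum `q`.
  have hdecomp : infPredSeq x (m + 1) = EllOne.unit k - EllOne.conv 1 (invMaCoeff x) q := by
    rw [eq_sub_iff_add_eq, infPredSeq, ← map_add]
    have : EllOne.restrict (Set.Ici 1) (EllOne.conv 1 (maCoeff x) (EllOne.unit k)) + q =
        EllOne.conv 1 (maCoeff x) (EllOne.unit k) := by
      ext i
      simp only [q, lp.coeFn_add, Pi.add_apply, EllOne.restrict_apply, Set.mem_Ici, Set.mem_Iio]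
      by_cases hi : i < 1
      · simp [hi, not_le.2 hi]
      · simp [hi, not_lt.1 hi]
    rw [this, EllOne.conv_apply_conv_apply 1 hx.summable_inv hx.summable_ma hx.mk_mul_mk']
  rw [hx.predTail_eq, hdecomp, map_sub, EllOne.restrict_eq_zero (f := EllOne.unit k), zero_sub,
    norm_neg, hq, map_sum, map_sum]
  · refine (norm_sum_le _ _).trans (Finset.sum_le_sum fun l hl => ?_)
    have hl' := Finset.mem_range.1 hl
    rw [map_smul, map_smul, norm_smul, Real.norm_eq_abs]
    refine mul_le_mul_of_nonneg_left ?_ (abs_nonneg _)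
    -- The unit sits at `k + l = l - m`, so at least `n + (m - l) + 1` steps are needed to pass `n`.
    have h := EllOne.norm_restrict_conv_le (r := 1) hx.summable_inv (f := EllOne.unit (k + l))
      (s := Set.Ioi (n : ℤ)) (n := n + (m - l)) fun j hj i hi => by
        have hi' : (n : ℤ) < i := hi
        rw [EllOne.unit_apply, if_neg]
        omega
    simpa only [EllOne.norm_unit, mul_one, abs_invMaCoeff] using h
  · intro i hi
    have hi' : (n : ℤ) < i := hi
    rw [EllOne.unit_apply, if_neg]
    omega

end IsRegular

end Hilbert

end LinearPrediction

/-! ### Asymptotics of tails under polynomial weights. -/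

namespace LinearPrediction

/-- Sum along antidiagonals: `i + j = k` has `k + 1` solutions. -/
theorem summable_tsum_add_and_tsum_eq {F : ℕ → ℝ} (hF : ∀ k, 0 ≤ F k)
    (hs : Summable fun k : ℕ => ((k : ℝ) + 1) * F k) :
    (Summable fun i => ∑' j, F (i + j)) ∧ ∑' i, ∑' j, F (i + j) = ∑' k : ℕ, ((k : ℝ) + 1) * F k := by
  let e := Finset.HasAntidiagonal.sigmaAntidiagonalEquivProd (A := ℕ)
  have hfib : ∀ n, ∑ p : Finset.HasAntidiagonal.antidiagonal n, F (p.1.1 + p.1.2) =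
      ((n : ℝ) + 1) * F n := fun n => by
    rw [Finset.sum_coe_sort (Finset.HasAntidiagonal.antidiagonal n) fun p : ℕ × ℕ => F (p.1 + p.2),
      Finset.sum_congr rfl fun p hp => by rw [Finset.HasAntidiagonal.mem_antidiagonal.1 hp]]
    simp
  have hsig : Summable ((fun p : ℕ × ℕ => F (p.1 + p.2)) ∘ e) := by
    refine (summable_sigma_of_nonneg fun p => hF ((e p).1 + (e p).2)).2
      ⟨fun n => Summable.of_finite, hs.congr fun n => ?_⟩
    rw [tsum_fintype]
    exact (hfib n).symm
  have hprod : Summable fun p : ℕ × ℕ => F (p.1 + p.2) := e.summable_iff.1 hsig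
  refine ⟨hprod.prod, ?_⟩
  rw [← hprod.tsum_prod, ← e.tsum_eq]
  refine (Summable.tsum_sigma hsig).trans ?_
  refine tsum_congr fun n => ?_
  rw [tsum_fintype]
  exact hfib n

/-- For non-summable `g` every tail is `0` by the convention for `∑'`. -/
theorem tendsto_tsum_nat_add (g : ℕ → ℝ) :
    Tendsto (fun n => ∑' j, g (n + 1 + j)) atTop (𝓝 0) := by
  refine ((tendsto_add_atTop_iff_nat 1).2 (tendsto_sum_nat_add g)).congr fun n => ?_
  exact tsum_congr fun j => congr_arg g (add_comm _ _)

theorem isLittleO_of_le_rpow_mul_tail {T g : ℕ → ℝ} {β : ℝ}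
    (hT : ∀ n, 0 ≤ T n) (h : ∀ n : ℕ, 1 ≤ n → T n ≤ (n : ℝ) ^ β * ∑' j, g (n + 1 + j)) :
    T =o[atTop] fun n : ℕ => (n : ℝ) ^ β := by
  have h1 : (fun n : ℕ => (n : ℝ) ^ β * ∑' j, g (n + 1 + j)) =o[atTop]
      fun n : ℕ => (n : ℝ) ^ β := by
    simpa using (isBigO_refl (fun n : ℕ => (n : ℝ) ^ β) atTop).mul_isLittleO
      ((isLittleO_one_iff ℝ).2 (tendsto_tsum_nat_add g))
  refine IsBigO.trans_isLittleO (IsBigO.of_bound 1 ?_) h1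
  filter_upwards [eventually_ge_atTop 1] with n hn
  rw [Real.norm_of_nonneg (hT n), one_mul]
  exact (h n hn).trans (le_abs_self _)

theorem summable_nat_add_left {f : ℕ → ℝ} (hf : Summable f) (n : ℕ) :
    Summable fun j => f (n + j) := by
  simpa only [add_comm] using (summable_nat_add_iff n).2 hf

section Weighted

variable {φ : ℕ → ℝ} {α : ℝ}

theorem summable_abs_of_weighted (hα : 0 ≤ α)
    (h : Summable fun j : ℕ => (1 + (j : ℝ)) ^ α * |φ j|) : Summable fun j => |φ j| :=
  Summable.of_nonneg_of_le (fun _ => abs_nonneg _)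
    (fun j => le_mul_of_one_le_left (abs_nonneg _)
      (Real.one_le_rpow (by linarith [Nat.cast_nonneg (α := ℝ) j]) hα)) h

theorem tail_isLittleO (hα : 0 ≤ α) (h : Summable fun j : ℕ => (1 + (j : ℝ)) ^ α * |φ j|) :
    (fun n => ∑' j, |φ (n + 1 + j)|) =o[atTop] fun n : ℕ => (n : ℝ) ^ (-α) := by
  refine isLittleO_of_le_rpow_mul_tail
    (g := fun j => (1 + (j : ℝ)) ^ α * |φ j|) (fun n => tsum_nonneg fun _ => abs_nonneg _)
    fun n hn => ?_
  have hn0 : (0 : ℝ) < n := by exact_mod_cast hn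
  rw [← tsum_mul_left]
  refine Summable.tsum_le_tsum (fun j => ?_)
    (summable_nat_add_left (summable_abs_of_weighted hα h) (n + 1))
    ((summable_nat_add_left h (n + 1)).mul_left _)
  rw [← mul_assoc]
  refine le_mul_of_one_le_left (abs_nonneg _) ?_
  rw [Real.rpow_neg hn0.le, inv_mul_eq_div, one_le_div (Real.rpow_pos_of_pos hn0 _)]
  refine Real.rpow_le_rpow hn0.le ?_ hα
  push_cast
  linarith [Nat.cast_nonneg (α := ℝ) j]

theorem summable_mul_tail (hα : 1 ≤ α) (h : Summable fun j : ℕ => (1 + (j : ℝ)) ^ α * |φ j|)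
    (n : ℕ) : Summable fun k : ℕ => ((k : ℝ) + 1) * |φ (n + 1 + k)| := by
  refine Summable.of_nonneg_of_le (fun k => by positivity) (fun k => ?_)
    (summable_nat_add_left h (n + 1))
  refine mul_le_mul_of_nonneg_right ?_ (abs_nonneg _)
  push_cast
  have hn := Nat.cast_nonneg (α := ℝ) n
  have hk := Nat.cast_nonneg (α := ℝ) k
  calc (k : ℝ) + 1 ≤ 1 + (n + 1 + k) := by linarith
    _ ≤ (1 + ((n : ℝ) + 1 + k)) ^ α := Real.self_le_rpow_of_one_le (by linarith) hα

theorem summable_tail_add (hα : 1 ≤ α) (h : Summable fun j : ℕ => (1 + (j : ℝ)) ^ α * |φ j|)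
    (n : ℕ) : Summable fun i => ∑' j, |φ (n + i + 1 + j)| := by
  refine (summable_tsum_add_and_tsum_eq (fun _ => abs_nonneg _)
    (summable_mul_tail hα h n)).1.congr fun i => tsum_congr fun j => ?_
  congr 2
  ring

theorem tail_add_isLittleO (hα : 1 ≤ α) (h : Summable fun j : ℕ => (1 + (j : ℝ)) ^ α * |φ j|) :
    (fun n => ∑' i, ∑' j, |φ (n + i + 1 + j)|) =o[atTop] fun n : ℕ => (n : ℝ) ^ (-α + 1) := by
  refine isLittleO_of_le_rpow_mul_tail (g := fun j => (1 + (j : ℝ)) ^ α * |φ j|)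
    (fun n => tsum_nonneg fun _ => tsum_nonneg fun _ => abs_nonneg _) fun n hn => ?_
  have hn0 : (0 : ℝ) < n := by exact_mod_cast hn
  have heq : ∑' i, ∑' j, |φ (n + i + 1 + j)| = ∑' k : ℕ, ((k : ℝ) + 1) * |φ (n + 1 + k)| := by
    rw [← (summable_tsum_add_and_tsum_eq (fun _ => abs_nonneg _) (summable_mul_tail hα h n)).2]
    refine tsum_congr fun i => tsum_congr fun j => ?_
    congr 2
    ring
  rw [heq, ← tsum_mul_left]
  refine Summable.tsum_le_tsum (fun k => ?_) (summable_mul_tail hα h n)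
    ((summable_nat_add_left h (n + 1)).mul_left _)
  rw [← mul_assoc]
  refine mul_le_mul_of_nonneg_right ?_ (abs_nonneg _)
  push_cast
  have hk := Nat.cast_nonneg (α := ℝ) k
  have hb : (0 : ℝ) < 1 + ((n : ℝ) + 1 + k) := by linarith
  -- One power of the weight is split as exponents `1 - α` and `α`; since `1 - α ≤ 0`, the first
  -- base may be lowered to `n`.
  calc (k : ℝ) + 1 ≤ 1 + (n + 1 + k) := by linarith
    _ = (1 + ((n : ℝ) + 1 + k)) ^ (-α + 1) * (1 + ((n : ℝ) + 1 + k)) ^ α := by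
      rw [← Real.rpow_add hb]; simp
    _ ≤ (n : ℝ) ^ (-α + 1) * (1 + ((n : ℝ) + 1 + k)) ^ α := by
      refine mul_le_mul_of_nonneg_right ?_ (Real.rpow_nonneg hb.le _)
      exact Real.rpow_le_rpow_of_nonpos hn0 (by linarith) (by linarith)

end Weighted

/-! ### Bounds uniform in `m`, bounds summed over `m`, and the choice of `N₁`. -/

section Hilbert

variable {H : Type*} [NormedAddCommGroup H] [InnerProductSpace ℝ H] [CompleteSpace H] {x : ℤ → H}

theorem predTail_nonneg (m n : ℕ) : 0 ≤ predTail x m n := tsum_nonneg fun _ => abs_nonneg _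

namespace IsRegular

variable (hx : IsRegular x)
include hx

/-- Tails of `φ` decrease, so each tail in `predTail_succ_le` is at most the one starting at `n +
1`. -/
theorem predTail_succ_le_mul (m n : ℕ) :
    predTail x (m + 1) n ≤ (∑' j, |maCoeff x j|) * ∑' j, |arCoeff x (n + 1 + j)| := by
  refine (hx.predTail_succ_le m n).trans ?_
  calc _ ≤ ∑ l ∈ Finset.range (m + 1), |maCoeff x l| * ∑' j, |arCoeff x (n + 1 + j)| := by
        refine Finset.sum_le_sum fun l _ => mul_le_mul_of_nonneg_left ?_ (abs_nonneg _)
        have h := summable_nat_add_left hx.summable_ar (n + 1)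
        have h' := h.sum_add_tsum_nat_add (m - l)
        have h0 : 0 ≤ ∑ i ∈ Finset.range (m - l), |arCoeff x (n + 1 + i)| :=
          Finset.sum_nonneg fun _ _ => abs_nonneg _
        have h1 : ∑' j, |arCoeff x (n + (m - l) + 1 + j)| =
            ∑' j, |arCoeff x (n + 1 + (j + (m - l)))| :=
          tsum_congr fun j => by congr 2; ring
        linarith
    _ ≤ _ := by
        rw [← Finset.sum_mul]
        exact mul_le_mul_of_nonneg_right
          (hx.summable_ma.sum_le_tsum _ fun _ _ => abs_nonneg _)
          (tsum_nonneg fun _ => abs_nonneg _)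

theorem bddAbove_predTail (n : ℕ) : BddAbove (Set.range fun m : ℕ => predTail x (m + 1) n) :=
  ⟨_, by rintro _ ⟨m, rfl⟩; exact hx.predTail_succ_le_mul m n⟩

theorem iSup_predTail_isLittleO {α : ℝ} (hα : 0 ≤ α)
    (h : Summable fun j : ℕ => (1 + (j : ℝ)) ^ α * |arCoeff x j|) :
    (fun n : ℕ => ⨆ m : ℕ, predTail x (m + 1) n) =o[atTop] fun n : ℕ => (n : ℝ) ^ (-α) := by
  refine IsBigO.trans_isLittleO (IsBigO.of_bound (∑' j, |maCoeff x j|) (.of_forall fun n => ?_))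
    (tail_isLittleO hα h)
  rw [Real.norm_of_nonneg (Real.iSup_nonneg fun m => predTail_nonneg _ _),
    Real.norm_of_nonneg (tsum_nonneg fun _ => abs_nonneg _)]
  exact ciSup_le fun m => hx.predTail_succ_le_mul m n

/-- The bound in `predTail_succ_le` is the `m`-th term of a Cauchy product, whose sum is the product
of the two sums. -/
theorem summable_predTail_and_tsum_le {α : ℝ} (hα : 1 ≤ α)
    (h : Summable fun j : ℕ => (1 + (j : ℝ)) ^ α * |arCoeff x j|) (n : ℕ) :
    (Summable fun m : ℕ => predTail x (m + 1) n) ∧ ∑' m : ℕ, predTail x (m + 1) n ≤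
      (∑' j, |maCoeff x j|) * ∑' i, ∑' j, |arCoeff x (n + i + 1 + j)| := by
  have hs := hasSum_sum_range_mul_of_summable_norm (f := fun j => |maCoeff x j|)
    (g := fun i => ∑' j, |arCoeff x (n + i + 1 + j)|) hx.summable_ma.norm
    (summable_tail_add hα h n).norm
  have hsum : Summable fun m : ℕ => predTail x (m + 1) n :=
    Summable.of_nonneg_of_le (fun m => predTail_nonneg _ _) (fun m => hx.predTail_succ_le m n)
      hs.summable
  exact ⟨hsum, hasSum_le (fun m => hx.predTail_succ_le m n) hsum.hasSum hs⟩

theorem tsum_predTail_isLittleO {α : ℝ} (hα : 1 ≤ α)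
    (h : Summable fun j : ℕ => (1 + (j : ℝ)) ^ α * |arCoeff x j|) :
    (fun n : ℕ => ∑' m : ℕ, predTail x (m + 1) n) =o[atTop] fun n : ℕ => (n : ℝ) ^ (-α + 1) := by
  refine IsBigO.trans_isLittleO (IsBigO.of_bound (∑' j, |maCoeff x j|) (.of_forall fun n => ?_))
    (tail_add_isLittleO hα h)
  rw [Real.norm_of_nonneg (tsum_nonneg fun m => predTail_nonneg _ _),
    Real.norm_of_nonneg (tsum_nonneg fun _ => tsum_nonneg fun _ => abs_nonneg _)]
  exact (hx.summable_predTail_and_tsum_le hα h n).2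

theorem exists_forall_baxter {ε : ℝ} (hε : 0 < ε) (hε1 : ε < 1) :
    ∃ N₁ : ℕ, 1 ≤ N₁ ∧ ∀ m n : ℕ, N₁ ≤ n →
      ∑ k ∈ Finset.Icc 1 n, |infPredCoeff x m k - finPredCoeff x m n k| ≤
        baxterConst x ε * predTail x m n := by
  have h0 : Tendsto (fun n => (∑' j, |maCoeff x j|) ^ 2 * (∑' j, |arCoeff x j|) *
      ∑' j, |arCoeff x (n + 1 + j)|) atTop (𝓝 0) := by
    simpa only [mul_zero] using (tendsto_tsum_nat_add fun j => |arCoeff x j|).const_mul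
      ((∑' j, |maCoeff x j|) ^ 2 * (∑' j, |arCoeff x j|))
  -- `ε` plays the role of `δ`. This yields the factor `1 / (1 - ε)`, which is below `(3 - ε) / (1 -
  -- ε)`.
  obtain ⟨N, hN⟩ := eventually_atTop.1 (h0.eventually (ge_mem_nhds hε))
  refine ⟨max N 1, le_max_right _ _, fun m n hn => ?_⟩
  refine (hx.baxter hε1 (hN n (le_of_max_le_left hn)) m).trans
    (mul_le_mul_of_nonneg_right ?_ (predTail_nonneg _ _))
  rw [baxterConst, mul_assoc, div_mul_eq_mul_div]
  exact div_le_div_of_nonneg_right (le_mul_of_one_le_left (by positivity) (by linarith))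
    (by linarith)

end IsRegular

end Hilbert

/-! ### From the process on `Ω` to the sequence in `L²`. -/

namespace IsCenteredStationary

variable {Ω : Type*} [MeasurableSpace Ω] {X : ℤ → Ω → ℝ} {P : Measure Ω}

/-- Centering makes the covariance equal to the `L²` inner product, which turns weak stationarity
into shift invariance of the Gram matrix. -/
theorem inner_toL2 (hX : IsCenteredStationary X P) (s t : ℤ) :
    inner ℝ (hX.toL2 s) (hX.toL2 t) = cov[X s, X t; P] := by
  rw [L2.inner_def, covariance]
  refine integral_congr_ae ?_
  filter_upwards [(hX.memLp s).coeFn_toLp, (hX.memLp t).coeFn_toLp] with ω hs ht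
  rw [toL2, toL2, hs, ht, hX.centered, hX.centered, sub_zero, sub_zero]
  exact mul_comm _ _

theorem isGramStationary_toL2 (hX : IsCenteredStationary X P) : IsGramStationary hX.toL2 :=
  fun s t h => by rw [hX.inner_toL2, hX.inner_toL2, hX.cov_shift]

theorem toL2_ne_zero (hX : IsCenteredStationary X P) {t : ℤ} (h : 0 < Var[X t; P]) :
    hX.toL2 t ≠ 0 := by
  intro h0
  have := hX.inner_toL2 t t
  rw [h0, inner_zero_left, covariance_self (hX.memLp t).aestronglyMeasurable.aemeasurable] at this
  exact h.ne this

theorem isRegular_toL2 (hX : IsCenteredStationary X P) (hvar : 0 < Var[X 0; P])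
    (hpnd : IsPurelyNondeterministic hX.toL2) {α : ℝ} (hα : 0 ≤ α)
    (hSM : IsShortMemory hX.toL2 α) : IsRegular hX.toL2 where
  gram := hX.isGramStationary_toL2
  pnd := hpnd
  ne_zero := hX.toL2_ne_zero hvar
  summable_ma := summable_abs_of_weighted hα hSM.1
  summable_ar := summable_abs_of_weighted hα hSM.2

end IsCenteredStationary

end LinearPrediction

theorem theorem4p1 {Ω : Type*} [MeasurableSpace Ω] (P : Measure Ω) [IsProbabilityMeasure P]
    (X : ℤ → Ω → ℝ) (hX : IsCenteredStationary X P) (hvar : 0 < Var[X 0; P])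
    (hpnd : IsPurelyNondeterministic hX.toL2)
    (α : ℝ) (hα : 0 ≤ α) (hSM : IsShortMemory hX.toL2 α) :
    (∀ m : ℕ, 1 ≤ m → Summable (fun k : ℕ => |infPredCoeff hX.toL2 m k|)) ∧
    (∀ ε : ℝ, 0 < ε → ε < 1 → ∃ N₁ : ℕ, 1 ≤ N₁ ∧ ∀ m : ℕ, 1 ≤ m → ∀ n : ℕ, N₁ ≤ n →
      ∑ k ∈ Finset.Icc 1 n, |infPredCoeff hX.toL2 m k - finPredCoeff hX.toL2 m n k|
        ≤ baxterConst hX.toL2 ε * predTail hX.toL2 m n) ∧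
    ((∀ n : ℕ, BddAbove (Set.range fun m : ℕ => predTail hX.toL2 (m + 1) n)) ∧
      (fun n : ℕ => ⨆ m : ℕ, predTail hX.toL2 (m + 1) n)
        =o[atTop] (fun n : ℕ => (n : ℝ) ^ (-α))) ∧
    (1 ≤ α →
      (∀ n : ℕ, Summable (fun m : ℕ => predTail hX.toL2 (m + 1) n)) ∧
      (fun n : ℕ => ∑' m : ℕ, predTail hX.toL2 (m + 1) n)
        =o[atTop] (fun n : ℕ => (n : ℝ) ^ (-α + 1))) := by
  have hx := hX.isRegular_toL2 hvar hpnd hα hSM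
  refine ⟨fun m _ => hx.summable_abs_infPredCoeff m, fun ε hε hε1 => ?_,
    ⟨hx.bddAbove_predTail, hx.iSup_predTail_isLittleO hα hSM.2⟩,
    fun hα1 => ⟨fun n => (hx.summable_predTail_and_tsum_le hα1 hSM.2 n).1,
      hx.tsum_predTail_isLittleO hα1 hSM.2⟩⟩
  obtain ⟨N₁, hN₁, h⟩ := hx.exists_forall_baxter hε hε1
  exact ⟨N₁, hN₁, fun m _ n hn => h m n hn⟩
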